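/- Let $N=\{1,\dots,n\}$ with $n\ge 1$, let $A_C\in\mathbb{R}$ be the (advantage) value of each coalition $C\subseteq N$ (arbitrary real numbers), and let $\lambda\in\mathbb{R}$ be a regularization coefficient. For coalitions $C_1,\dots,C_m\subseteq N$ (repetitions allowed) consider the sampled regularized least $\epsilon$-core program $$\min_{\epsilon\ge 0,\;A_1,\dots,A_n\in\mathbb{R}}\ \epsilon+\lambda\sum_{i\in N}\Big(A_i-\tfrac1n A_N\Big)^2\quad\text{subject to}\quad \sum_{i\in N}A_i=A_N,\qquad \sum_{i\in C_k}A_i\ge A_{C_k}-\epsilon\ \ (k=1,\dots,m).$$ For a probability distribution $\mathcal P$ on $2^N$ and $\delta>0$, $\epsilon\ge 0$, say that an allocation $(A_1,\dots,A_n)\in\mathbb{R}^n$ lies in the $\delta$-probable core with slack $\epsilon$ if $\sum_{i\in N}A_i=A_N$ and $$\Pr_{C\sim\mathcal P}\Big[\sum_{i\in C}A_i\ge A_C-\epsilon\Big]\ge 1-\delta .$$ **Theorem.** For every $\delta_0<1$ there is a constant $K>0$, depending only on $\delta_0$, such that for all $n\ge1$, all values $(A_C)_{C\subseteq N}$, all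 $\lambda\in\mathbb{R}$, all distributions $\mathcal P$ on $2^N$, all $\delta\in(0,\delta_0]$, all $\Delta>0$ and every integer $m\ge 0$ with $$m\ \ge\ K\,\frac{(n+2)\log(1/\delta)+\log(1/\Delta)}{\delta^2}$$ the following holds. If $\lambda>0$, the program has an optimal solution for every choice of $C_1,\dots,C_m$. Moreover, if $C_1,\dots,C_m$ are drawn independently from $\mathcal P$, then with probability at least $1-\Delta$ every optimal solution $(\hat A,\hat\epsilon)$ of the program is such that $\hat A$ lies in the $\delta$-probable core with slack $\hat\epsilon$. -/

import Mathlib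

open MeasureTheory

/-- Coalitions of the agents `{0, …, n-1}`: the finite set `2^N`. -/
abbrev Coalition (n : ℕ) : Type := Finset (Fin n)

/-- Every set of coalitions is an event. -/
instance Coalition.instMeasurableSpace (n : ℕ) : MeasurableSpace (Coalition n) := ⊤

/-- Feasibility of `(A, ε)` for the program whose coalition constraints are those of the coalitions
`C 0, …, C (m-1)`. Here `v C` is the (advantage) value of the coalition `C`. -/
structure IsSampledFeasible {n m : ℕ} (v : Coalition n → ℝ) (C : Fin m → Coalition n)
    (A : Fin n → ℝ) (ε : ℝ) : Prop where
  slack_nonneg : 0 ≤ ε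
  efficient : ∑ i, A i = v Finset.univ
  rational : ∀ k, v (C k) - ε ≤ ∑ i ∈ C k, A i

/-- The objective `ε + lam * ∑ i, (A i - v N / |N|)^2`. -/
noncomputable def regularizedObjective {n : ℕ} (v : Coalition n → ℝ) (lam : ℝ)
    (A : Fin n → ℝ) (ε : ℝ) : ℝ :=
  ε + lam * ∑ i, (A i - 1 / (n : ℝ) * v Finset.univ) ^ 2

/-- `(A, ε)` is an optimal solution of the regularized least `ε`-core program over the coalitions
`C 0, …, C (m-1)`. -/
structure IsSampledSolution {n m : ℕ} (v : Coalition n → ℝ) (lam : ℝ) (C : Fin m → Coalition n)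
    (A : Fin n → ℝ) (ε : ℝ) : Prop where
  feasible : IsSampledFeasible v C A ε
  optimal : ∀ (A' : Fin n → ℝ) (ε' : ℝ), IsSampledFeasible v C A' ε' →
    regularizedObjective v lam A ε ≤ regularizedObjective v lam A' ε'

/-- The `δ`-probable core with slack `ε` with respect to the distribution `P` on coalitions:
efficient allocations for which a coalition drawn from `P` satisfies the strong `ε`-core
constraint with probability at least `1 - δ`. -/
def probableCore {n : ℕ} (v : Coalition n → ℝ) (P : Measure (Coalition n)) (ε δ : ℝ) :
    Set (Fin n → ℝ) :=
  {A | ∑ i, A i = v Finset.univ ∧ 1 - δ ≤ P.real {C | v C - ε ≤ ∑ i ∈ C, A i}}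

/-! A feasible pair `(A, ε)` violates no sampled constraint, so the sample misses its violation set;
if `A` is outside the `δ`-probable core, that set has mass more than `δ`. It is enough that the
sample meets every violation set of mass more than `δ`, so optimality and the sign of `lam` play no
role in the probability bound. Violation sets are halfspaces in `n + 2` coordinates, hence have VC
dimension at most `n + 2` (`vcDim_violationSets_le`), and the `ε`-net theorem
(`prob_not_net_mul_le`) applies. It is proved by double sampling: a heavy set missed by the sample
is often hit by a ghost sample, which is unlikely under random swaps of the two; Sauer–Shelah bounds
the number of traces. Existence of an optimum is a compactness argument. -/

/-! ### VC dimension: halfspaces, traces, Sauer–Shelah -/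

/-- Too many vectors satisfy a linear relation; a halfspace cutting out exactly its positive
coefficients would pair with it to a positive number instead of zero. -/
theorem Finset.card_le_card_of_shatters_halfspaces {α κ : Type*} [DecidableEq α] [Fintype κ]
    (φ : α → κ → ℝ) (𝓗 : Finset (Finset α))
    (h𝓗 : ∀ H ∈ 𝓗, ∃ w : κ → ℝ, ∀ a, a ∈ H ↔ 0 < ∑ k, w k * φ a k)
    {s : Finset α} (hs : 𝓗.Shatters s) : s.card ≤ Fintype.card κ := by
  classical
  by_contra! hcard
  have hdep : ¬ LinearIndependent ℝ (fun a : s => φ a) := by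
    intro h
    have := h.fintype_card_le_finrank
    simp at this
    omega
  obtain ⟨c, hc, a₀, ha₀⟩ := Fintype.not_linearIndependent_iff.1 hdep
  have key : ∀ c : s → ℝ, ∑ a, c a • φ a = 0 → ∀ a₁, 0 < c a₁ → False := by
    intro c hc a₁ ha₁
    obtain ⟨H, hH, hHs⟩ := hs (t := s.filter (fun a => ∃ h : a ∈ s, 0 < c ⟨a, h⟩))
      (Finset.filter_subset _ _)
    obtain ⟨w, hw⟩ := h𝓗 H hH
    have hmem : ∀ a : s, 0 < ∑ k, w k * φ a k ↔ 0 < c a := by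
      intro a
      rw [← hw]
      have := Finset.ext_iff.1 hHs a
      simpa using this
    have hzero : ∑ a, c a * ∑ k, w k * φ a k = 0 := by
      calc ∑ a, c a * ∑ k, w k * φ a k = ∑ k, w k * (∑ a, c a • φ a) k := by
            simp only [Finset.mul_sum, Finset.sum_apply, Pi.smul_apply, smul_eq_mul]
            rw [Finset.sum_comm]
            refine Finset.sum_congr rfl fun k _ => Finset.sum_congr rfl fun a _ => by ring
        _ = 0 := by rw [hc]; simp
    have hpos : 0 < ∑ a, c a * ∑ k, w k * φ a k := by
      refine Finset.sum_pos' (fun a _ => ?_) ⟨a₁, Finset.mem_univ _, mul_pos ha₁ ((hmem a₁).2 ha₁)⟩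
      by_cases h : 0 < c a
      · exact (mul_pos h ((hmem a).2 h)).le
      · exact mul_nonneg_of_nonpos_of_nonpos (not_lt.1 h) (not_lt.1 fun h' => h ((hmem a).1 h'))
    exact hpos.ne' hzero
  -- The argument needs a positive coefficient; otherwise negate the relation.
  rcases lt_or_gt_of_ne ha₀ with h | h
  · exact key (fun a => -c a) (by simp only [neg_smul, Finset.sum_neg_distrib, hc, neg_zero]) a₀
      (by simpa using h)
  · exact key c hc a₀ h

/-- The trace on the index set `ι` of a set family, along a labelling `z` of `ι`. -/
def Finset.pullback {α ι : Type*} [DecidableEq α] [Fintype ι] [DecidableEq ι]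
    (𝓗 : Finset (Finset α)) (z : ι → α) : Finset (Finset ι) :=
  𝓗.image fun H => Finset.univ.filter fun j => z j ∈ H

/-- Indices with equal labels cannot be separated, so `z` is injective on a shattered set, and its
image is shattered by `𝓗`. -/
theorem Finset.vcDim_pullback_le {α ι : Type*} [DecidableEq α] [Fintype ι] [DecidableEq ι]
    (𝓗 : Finset (Finset α)) (z : ι → α) : (𝓗.pullback z).vcDim ≤ 𝓗.vcDim := by
  refine Finset.sup_le fun s hs => ?_
  rw [Finset.mem_shatterer] at hs
  have htrace : ∀ t ⊆ s, ∃ H ∈ 𝓗, ∀ j ∈ s, z j ∈ H ↔ j ∈ t := by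
    intro t ht
    obtain ⟨u, hu, hut⟩ := hs ht
    obtain ⟨H, hH, rfl⟩ := Finset.mem_image.1 hu
    refine ⟨H, hH, fun j hj => ?_⟩
    rw [← hut]
    simp [hj]
  have hinj : Set.InjOn z s := by
    intro a ha b hb hab
    obtain ⟨H, -, hH⟩ := htrace {a} (by simpa using ha)
    have h := (hH a ha).2 (by simp)
    rw [hab, hH b hb] at h
    exact (Finset.mem_singleton.1 h).symm
  rw [← Finset.card_image_of_injOn hinj]
  refine Finset.Shatters.card_le_vcDim fun t ht => ?_
  obtain ⟨H, hH, hHt⟩ := htrace (s.filter fun j => z j ∈ t) (Finset.filter_subset _ _)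
  refine ⟨H, hH, ?_⟩
  ext a
  constructor
  · intro ha
    obtain ⟨ha, haH⟩ := Finset.mem_inter.1 ha
    obtain ⟨j, hj, rfl⟩ := Finset.mem_image.1 ha
    exact (Finset.mem_filter.1 ((hHt j hj).1 haH)).2
  · intro ha
    obtain ⟨j, hj, rfl⟩ := Finset.mem_image.1 (ht ha)
    exact Finset.mem_inter.2 ⟨ht ha, (hHt j hj).2 (Finset.mem_filter.2 ⟨hj, ha⟩)⟩

/-- Sauer–Shelah as a generating function: there are at least as many shattered sets as members,
each of size at most `D`. The free `t` avoids estimating binomial sums. -/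
theorem Finset.card_mul_pow_vcDim_le {ι : Type*} [Fintype ι] [DecidableEq ι]
    (𝓐 : Finset (Finset ι)) {D : ℕ} (hD : 𝓐.vcDim ≤ D) {t : ℝ} (ht₀ : 0 ≤ t) (ht₁ : t ≤ 1) :
    (𝓐.card : ℝ) * t ^ D ≤ (1 + t) ^ Fintype.card ι := by
  calc (𝓐.card : ℝ) * t ^ D ≤ 𝓐.shatterer.card * t ^ D := by
        refine mul_le_mul_of_nonneg_right ?_ (by positivity)
        exact_mod_cast 𝓐.card_le_card_shatterer
    _ = ∑ s ∈ 𝓐.shatterer, t ^ D := by simp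
    _ ≤ ∑ s ∈ 𝓐.shatterer, t ^ s.card := Finset.sum_le_sum fun s hs =>
        pow_le_pow_of_le_one ht₀ ht₁ ((Finset.mem_shatterer.1 hs).card_le_vcDim.trans hD)
    _ ≤ ∑ s : Finset ι, t ^ s.card :=
        Finset.sum_le_sum_of_subset_of_nonneg (Finset.subset_univ _) fun _ _ _ => by positivity
    _ = (1 + t) ^ Fintype.card ι := by
        have := Fintype.sum_pow_mul_eq_add_pow ι t 1
        simpa [add_comm] using this

/-! ### Double sampling and the `ε`-net theorem -/

/-- A transversal `σ` of `ι × Bool` chosen uniformly at random misses `S` with probability at most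
`2 ^ (-|S|)`. -/
theorem card_transversal_disjoint_mul_le {ι : Type*} [Fintype ι] [DecidableEq ι]
    (S : Finset (ι × Bool)) :
    (Finset.univ.filter fun σ : ι → Bool => ∀ i, (i, σ i) ∉ S).card * 2 ^ S.card
      ≤ 2 ^ Fintype.card ι := by
  have hpi : (Finset.univ.filter fun σ : ι → Bool => ∀ i, (i, σ i) ∉ S)
      = Fintype.piFinset fun i => Finset.univ.filter fun b => (i, b) ∉ S := by
    ext σ
    simp
  have hcard : S.card = ∑ i, (Finset.univ.filter fun b => (i, b) ∈ S).card := by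
    simp only [Finset.card_filter]
    rw [← Fintype.sum_prod_type' (f := fun i b => if (i, b) ∈ S then 1 else 0)]
    simp
  rw [hpi, Fintype.card_piFinset, hcard, ← Finset.prod_pow_eq_pow_sum, ← Finset.prod_mul_distrib,
    ← Finset.card_univ, ← Finset.prod_const]
  -- If `S` contains `r` of the two copies of `i`, the factor is `(2 - r) * 2 ^ r ≤ 2`.
  refine Finset.prod_le_prod' fun i _ => ?_
  simp only [Finset.card_filter, Fintype.sum_bool]
  by_cases h₁ : (i, true) ∈ S <;> by_cases h₂ : (i, false) ∈ S <;> simp [h₁, h₂]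

theorem sum_prod_mul_ite_mem {α ι : Type*} [Fintype α] [DecidableEq α] [Fintype ι] [DecidableEq ι]
    {p : α → ℝ} (hp : ∑ a, p a = 1) (H : Finset α) (i : ι) :
    ∑ y : ι → α, (∏ j, p (y j)) * (if y i ∈ H then 1 else 0) = ∑ a ∈ H, p a := by
  have h := Finset.prod_univ_sum (fun _ : ι => (Finset.univ : Finset α))
    (fun j a => p a * (if j = i then (if a ∈ H then (1 : ℝ) else 0) else 1))
  rw [Fintype.piFinset_univ] at h
  simp only [Finset.prod_mul_distrib, Finset.prod_ite_eq', Finset.mem_univ, if_true] at h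
  rw [← h, Finset.prod_eq_single i]
  · simp
  · intro j _ hj
    simp [hj, hp]
  · simp

theorem sum_prod_weight_eq_one {α ι : Type*} [Fintype α] [Fintype ι] [DecidableEq ι]
    {p : α → ℝ} (hp : ∑ a, p a = 1) : ∑ y : ι → α, ∏ j, p (y j) = 1 := by
  have h := Finset.prod_univ_sum (fun _ : ι => (Finset.univ : Finset α)) (fun _ a => p a)
  rw [Fintype.piFinset_univ] at h
  rw [← h]
  simp [hp]

/-- If `H` has mass more than `δ`, then with probability at least `δ / 2` a fraction at least
`δ / 2` of an independent sample falls into `H`. -/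
theorem half_le_prob_half_le_count {α ι : Type*} [Fintype α] [DecidableEq α] [Fintype ι]
    [DecidableEq ι] [Nonempty ι] {p : α → ℝ} (hp₀ : ∀ a, 0 ≤ p a) (hp : ∑ a, p a = 1)
    {δ : ℝ} (hδ : 0 < δ) {H : Finset α} (hH : δ < ∑ a ∈ H, p a) :
    δ / 2 ≤ ∑ y : ι → α, (∏ j, p (y j)) *
      (if ⌈δ / 2 * Fintype.card ι⌉₊ ≤ (Finset.univ.filter fun i => y i ∈ H).card
        then 1 else 0) := by
  set m : ℝ := (Fintype.card ι : ℝ) with hm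
  have hm0 : 0 < m := by rw [hm]; exact_mod_cast Fintype.card_pos
  set Q := ∑ y : ι → α, (∏ j, p (y j)) *
      (if ⌈δ / 2 * m⌉₊ ≤ (Finset.univ.filter fun i => y i ∈ H).card then (1 : ℝ) else 0) with hQ
  have hmean : ∑ y : ι → α, (∏ j, p (y j)) * ((Finset.univ.filter fun i => y i ∈ H).card : ℝ)
      = m * ∑ a ∈ H, p a := by
    simp only [Finset.card_filter, Nat.cast_sum, Finset.mul_sum _ _ (∏ j, p _)]
    rw [Finset.sum_comm]
    simp only [Nat.cast_ite, Nat.cast_one, Nat.cast_zero, sum_prod_mul_ite_mem hp H]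
    simp [hm]
  -- Reverse Markov: the count is at most `m` on the event and at most `δ / 2 * m` off it.
  have hle : ∑ y : ι → α, (∏ j, p (y j)) * ((Finset.univ.filter fun i => y i ∈ H).card : ℝ)
      ≤ m * Q + δ / 2 * m := by
    have : m * Q + δ / 2 * m = ∑ y : ι → α, (∏ j, p (y j)) *
        (m * (if ⌈δ / 2 * m⌉₊ ≤ (Finset.univ.filter fun i => y i ∈ H).card then (1 : ℝ) else 0)
          + δ / 2 * m) := by
      simp only [mul_add, Finset.sum_add_distrib]
      rw [← Finset.sum_mul, sum_prod_weight_eq_one hp, one_mul, hQ, Finset.mul_sum]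
      congr 1
      exact Finset.sum_congr rfl fun y _ => by ring
    rw [this]
    refine Finset.sum_le_sum fun y _ => mul_le_mul_of_nonneg_left ?_
      (Finset.prod_nonneg fun j _ => hp₀ _)
    split_ifs with h
    · have : ((Finset.univ.filter fun i => y i ∈ H).card : ℝ) ≤ m := by
        rw [hm]
        exact_mod_cast Finset.card_le_univ _
      have : 0 < δ / 2 * m := by positivity
      linarith
    · rw [Nat.ceil_le, not_le] at h
      linarith
  rw [hmean] at hle
  have : m * δ ≤ m * (Q + δ / 2) := by nlinarith
  have := le_of_mul_le_mul_left this hm0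
  linarith

/-- The pairs `(i, b)` with the two copies of `i` exchanged when `σ i` is true. -/
def swapEquiv {ι : Type*} (σ : ι → Bool) : ι × Bool ≃ ι × Bool where
  toFun j := (j.1, xor j.2 (σ j.1))
  invFun j := (j.1, xor j.2 (σ j.1))
  left_inv j := by simp
  right_inv j := by simp

open Classical in
/-- The probability that some member of `𝓗` misses the first half of a double sample but contains
at least `k` of its points. -/
theorem prob_double_sample_mul_le {α ι : Type*} [Fintype α] [DecidableEq α] [Fintype ι]
    [DecidableEq ι] {p : α → ℝ} (hp₀ : ∀ a, 0 ≤ p a) (hp : ∑ a, p a = 1)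
    (𝓗 : Finset (Finset α)) {D : ℕ} (hD : 𝓗.vcDim ≤ D) {t : ℝ} (ht₀ : 0 ≤ t) (ht₁ : t ≤ 1) (k : ℕ) :
    (∑ z : ι × Bool → α, (∏ j, p (z j)) *
      (if ∃ H ∈ 𝓗, (∀ i, z (i, false) ∉ H) ∧ k ≤ (Finset.univ.filter fun j => z j ∈ H).card
        then 1 else 0)) * (t ^ D * 2 ^ k) ≤ (1 + t) ^ (2 * Fintype.card ι) := by
  set X := ∑ z : ι × Bool → α, (∏ j, p (z j)) *
      (if ∃ H ∈ 𝓗, (∀ i, z (i, false) ∉ H) ∧ k ≤ (Finset.univ.filter fun j => z j ∈ H).card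
        then (1 : ℝ) else 0) with hX
  -- The product weight is invariant under swaps, so `X` may be averaged over `σ` with `z` fixed.
  have hswap : ∀ σ : ι → Bool, X = ∑ z : ι × Bool → α, (∏ j, p (z j)) *
      (if ∃ S ∈ 𝓗.pullback z, (∀ i, (i, σ i) ∉ S) ∧ k ≤ S.card then (1 : ℝ) else 0) := by
    intro σ
    symm
    refine Fintype.sum_equiv (Equiv.arrowCongr (swapEquiv σ).symm (Equiv.refl α)) _ _ fun z => ?_
    have hz : ∀ j, (Equiv.arrowCongr (swapEquiv σ).symm (Equiv.refl α)) z j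
      = z (swapEquiv σ j) := fun j => rfl
    simp only [hz]
    rw [Equiv.prod_comp (swapEquiv σ) fun j => p (z j)]
    congr 2
    have hcount : ∀ H : Finset α, (Finset.univ.filter fun j => z (swapEquiv σ j) ∈ H).card
        = (Finset.univ.filter fun j => z j ∈ H).card := by
      intro H
      exact Finset.card_equiv (swapEquiv σ) (by simp)
    simp only [hcount]
    simp [Finset.pullback, swapEquiv]
  -- Union bound over the traces on `z` with at least `k` points.
  have hcountσ : ∀ z : ι × Bool → α,
      (∑ σ : ι → Bool, if ∃ S ∈ 𝓗.pullback z, (∀ i, (i, σ i) ∉ S) ∧ k ≤ S.card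
        then (1 : ℝ) else 0) * (t ^ D * 2 ^ k)
      ≤ 2 ^ Fintype.card ι * (1 + t) ^ (2 * Fintype.card ι) := by
    intro z
    have h1 : (∑ σ : ι → Bool, if ∃ S ∈ 𝓗.pullback z, (∀ i, (i, σ i) ∉ S) ∧ k ≤ S.card
        then (1 : ℝ) else 0) * 2 ^ k ≤ (𝓗.pullback z).card * 2 ^ Fintype.card ι := by
      rw [Finset.sum_boole]
      have hsub : (Finset.univ.filter fun σ : ι → Bool =>
          ∃ S ∈ 𝓗.pullback z, (∀ i, (i, σ i) ∉ S) ∧ k ≤ S.card) ⊆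
          ((𝓗.pullback z).filter fun S => k ≤ S.card).biUnion fun S =>
            Finset.univ.filter fun σ : ι → Bool => ∀ i, (i, σ i) ∉ S := by
        intro σ hσ
        obtain ⟨S, hS, hS', hk⟩ := (Finset.mem_filter.1 hσ).2
        exact Finset.mem_biUnion.2 ⟨S, Finset.mem_filter.2 ⟨hS, hk⟩,
          Finset.mem_filter.2 ⟨Finset.mem_univ _, hS'⟩⟩
      have h2 := (Finset.card_le_card hsub).trans Finset.card_biUnion_le
      have h3 := Nat.mul_le_mul_right (2 ^ k) h2
      rw [Finset.sum_mul] at h3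
      have h4 : ∑ S ∈ (𝓗.pullback z).filter (fun S => k ≤ S.card),
          (Finset.univ.filter fun σ : ι → Bool => ∀ i, (i, σ i) ∉ S).card * 2 ^ k
          ≤ ∑ S ∈ (𝓗.pullback z).filter (fun S => k ≤ S.card), 2 ^ Fintype.card ι := by
        refine Finset.sum_le_sum fun S hS => ?_
        refine le_trans ?_ (card_transversal_disjoint_mul_le S)
        exact Nat.mul_le_mul_left _ (Nat.pow_le_pow_right (by norm_num) (Finset.mem_filter.1 hS).2)
      have h5 : ∑ S ∈ (𝓗.pullback z).filter (fun S => k ≤ S.card), 2 ^ Fintype.card ι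
          ≤ (𝓗.pullback z).card * 2 ^ Fintype.card ι := by
        rw [Finset.sum_const, smul_eq_mul]
        exact Nat.mul_le_mul_right _ (Finset.card_filter_le _ _)
      exact_mod_cast h3.trans (h4.trans h5)
    have h6 := (𝓗.pullback z).card_mul_pow_vcDim_le ((𝓗.vcDim_pullback_le z).trans hD) ht₀ ht₁
    rw [Fintype.card_prod, Fintype.card_bool, mul_comm (Fintype.card ι)] at h6
    calc _ = _ * 2 ^ k * t ^ D := by ring
      _ ≤ (𝓗.pullback z).card * 2 ^ Fintype.card ι * t ^ D :=
          mul_le_mul_of_nonneg_right h1 (by positivity)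
      _ = 2 ^ Fintype.card ι * ((𝓗.pullback z).card * t ^ D) := by ring
      _ ≤ _ := mul_le_mul_of_nonneg_left h6 (by positivity)
  have hsum : 2 ^ Fintype.card ι * X = ∑ z : ι × Bool → α, (∏ j, p (z j)) *
      ∑ σ : ι → Bool, if ∃ S ∈ 𝓗.pullback z, (∀ i, (i, σ i) ∉ S) ∧ k ≤ S.card
        then (1 : ℝ) else 0 := by
    simp only [Finset.mul_sum]
    rw [Finset.sum_comm]
    simp only [← hswap]
    simp
  refine le_of_mul_le_mul_left ?_ (show (0 : ℝ) < 2 ^ Fintype.card ι by positivity)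
  rw [← mul_assoc, hsum, Finset.sum_mul]
  calc _ ≤ ∑ z : ι × Bool → α, (∏ j, p (z j)) *
        (2 ^ Fintype.card ι * (1 + t) ^ (2 * Fintype.card ι)) := by
        refine Finset.sum_le_sum fun z _ => ?_
        rw [mul_assoc]
        exact mul_le_mul_of_nonneg_left (hcountσ z) (Finset.prod_nonneg fun j _ => hp₀ _)
    _ = _ := by rw [← Finset.sum_mul, sum_prod_weight_eq_one hp, one_mul]

open Classical in
/-- The `ε`-net theorem: the probability that an independent sample misses some member of `𝓗`
of mass more than `δ`. -/
theorem prob_not_net_mul_le {α ι : Type*} [Fintype α] [DecidableEq α] [Fintype ι]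
    [DecidableEq ι] [Nonempty ι] {p : α → ℝ} (hp₀ : ∀ a, 0 ≤ p a) (hp : ∑ a, p a = 1)
    (𝓗 : Finset (Finset α)) {D : ℕ} (hD : 𝓗.vcDim ≤ D) {δ t : ℝ} (hδ : 0 < δ) (ht₀ : 0 ≤ t) (ht₁ : t ≤ 1) :
    (∑ x : ι → α, (∏ i, p (x i)) *
      (if ∃ H ∈ 𝓗, δ < ∑ a ∈ H, p a ∧ ∀ i, x i ∉ H then 1 else 0)) * (δ / 2)
        * (t ^ D * 2 ^ ⌈δ / 2 * Fintype.card ι⌉₊) ≤ (1 + t) ^ (2 * Fintype.card ι) := by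
  refine le_trans (mul_le_mul_of_nonneg_right ?_ (by positivity))
    (prob_double_sample_mul_le hp₀ hp 𝓗 hD ht₀ ht₁ ⌈δ / 2 * Fintype.card ι⌉₊)
  set k := ⌈δ / 2 * Fintype.card ι⌉₊ with hk
  let e : (ι → α) × (ι → α) ≃ (ι × Bool → α) :=
    { toFun := fun xy j => if j.2 then xy.2 j.1 else xy.1 j.1
      invFun := fun z => (fun i => z (i, false), fun i => z (i, true))
      left_inv := fun xy => by simp
      right_inv := fun z => by ext ⟨i, b⟩; cases b <;> simp }
  rw [← Equiv.sum_comp e, Fintype.sum_prod_type, Finset.sum_mul]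
  refine Finset.sum_le_sum fun x _ => ?_
  have hw : ∀ x y : ι → α, ∏ j, p (e (x, y) j) = (∏ i, p (x i)) * ∏ i, p (y i) := by
    intro x y
    rw [Fintype.prod_prod_type, ← Finset.prod_mul_distrib]
    exact Finset.prod_congr rfl fun i _ => by simp [e, mul_comm]
  have hx : 0 ≤ ∏ i, p (x i) := Finset.prod_nonneg fun j _ => hp₀ _
  simp only [hw, mul_assoc]
  rw [← Finset.mul_sum]
  refine mul_le_mul_of_nonneg_left ?_ hx
  split_ifs with h
  · obtain ⟨H, hH, hHδ, hHx⟩ := h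
    rw [one_mul]
    -- With `x` and the missed set `H` fixed, only the ghost sample `y` is random.
    refine (half_le_prob_half_le_count (ι := ι) hp₀ hp hδ hHδ).trans ?_
    refine Finset.sum_le_sum fun y _ => mul_le_mul_of_nonneg_left ?_
      (Finset.prod_nonneg fun j _ => hp₀ _)
    split_ifs with h1 h2
    · exact le_rfl
    · refine absurd ⟨H, hH, fun i => by simpa [e] using hHx i, h1.trans ?_⟩ h2
      refine Finset.card_le_card_of_injOn (fun i => (i, true)) ?_ ?_
      · intro i hi
        simpa [e] using hi
      · intro i _ j _ hij
        simpa using hij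
    · exact zero_le_one
    · exact le_rfl
  · rw [zero_mul]
    refine Finset.sum_nonneg fun y _ => mul_nonneg (Finset.prod_nonneg fun j _ => hp₀ _) ?_
    split_ifs <;> norm_num

/-! ### Violation sets of the core constraints -/

open Classical in
/-- The sets of coalitions whose constraint is violated by some pair `(A, ε)`. -/
noncomputable def violationSets {n : ℕ} (v : Coalition n → ℝ) : Finset (Finset (Coalition n)) :=
  Finset.univ.filter fun H => ∃ (A : Fin n → ℝ) (ε : ℝ), ∀ C, C ∈ H ↔ ∑ i ∈ C, A i < v C - ε

theorem mem_violationSets {n : ℕ} (v : Coalition n → ℝ) {H : Finset (Coalition n)} :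
    H ∈ violationSets v ↔
      ∃ (A : Fin n → ℝ) (ε : ℝ), ∀ C, C ∈ H ↔ ∑ i ∈ C, A i < v C - ε := by
  classical
  simp [violationSets]

/-- Violation is a homogeneous linear inequality in the features `v C`, `1` and the indicator of
`C`, with weights `1`, `-ε` and `-A`. -/
theorem vcDim_violationSets_le {n : ℕ} (v : Coalition n → ℝ) :
    (violationSets v).vcDim ≤ n + 2 := by
  refine Finset.sup_le fun s hs => ?_
  rw [Finset.mem_shatterer] at hs
  let φ : Coalition n → Option (Option (Fin n)) → ℝ := fun C k =>
    k.elim (v C) fun k => k.elim 1 fun i => if i ∈ C then 1 else 0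
  have h := Finset.card_le_card_of_shatters_halfspaces φ (violationSets v) (fun H hH => ?_) hs
  · simpa using h
  · obtain ⟨A, ε, hA⟩ := (mem_violationSets v).1 hH
    refine ⟨fun k => k.elim 1 fun k => k.elim (-ε) fun i => -A i, fun C => ?_⟩
    rw [hA]
    simp only [Fintype.sum_option, φ, Option.elim, mul_ite, mul_one, mul_zero, one_mul,
      Finset.sum_ite_mem, Finset.univ_inter, Finset.sum_neg_distrib]
    constructor <;> intro h <;> linarith

/-! ### The sample size -/

/-- With `t = δ / 16` the right side is at most `exp (δ m / 8)`, while the power of two is at least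
`exp (δ m / 4)`; the remaining `exp (-δ m / 8)` absorbs the other factors. -/
theorem le_of_net_bound {δ₁ δ Δ X : ℝ} (hδ₁ : δ₁ < 1) (hδ : 0 < δ) (hδδ₁ : δ ≤ δ₁) (hΔ : 0 < Δ)
    (hΔ₁ : Δ ≤ 1) {D m : ℕ} (hD : 1 ≤ D)
    (hm : 16 * (Real.log 16 / Real.log (1 / δ₁) + 1) *
      (((D : ℝ) * Real.log (1 / δ) + Real.log (1 / Δ)) / δ ^ 2) ≤ m)
    (hX : X * (δ / 2) * ((δ / 16) ^ D * 2 ^ ⌈δ / 2 * m⌉₊) ≤ (1 + δ / 16) ^ (2 * m)) :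
    X ≤ Δ := by
  have hδ₁0 : 0 < δ₁ := hδ.trans_le hδδ₁
  have hL₁ : 0 < Real.log (1 / δ₁) := Real.log_pos (by rw [lt_div_iff₀ hδ₁0]; linarith)
  have hL : Real.log (1 / δ₁) ≤ Real.log (1 / δ) :=
    Real.log_le_log (by positivity) (one_div_le_one_div_of_le hδ hδδ₁)
  have hLΔ : 0 ≤ Real.log (1 / Δ) := Real.log_nonneg (by rw [le_div_iff₀ hΔ]; linarith)
  have h16 : 0 < Real.log 16 := Real.log_pos (by norm_num)
  set c := Real.log 16 / Real.log (1 / δ₁) + 1 with hc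
  have hc1 : 1 ≤ c := by
    have : 0 < Real.log 16 / Real.log (1 / δ₁) := by positivity
    linarith
  -- Keeping `δ` away from `1` lets `log (1 / δ)` absorb the constant `log 16`.
  have hlog16 : Real.log (16 / δ) ≤ c * Real.log (1 / δ) := by
    have h1 : Real.log (16 / δ) = Real.log 16 + Real.log (1 / δ) := by
      rw [← Real.log_mul (by norm_num) (by positivity)]
      congr 1
      ring
    have h2 : Real.log 16 ≤ Real.log 16 / Real.log (1 / δ₁) * Real.log (1 / δ) := by
      rw [div_mul_eq_mul_div, le_div_iff₀ hL₁]
      gcongr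
    rw [h1, hc]
    linarith
  have hlog2 : Real.log (2 / δ) ≤ Real.log (16 / δ) :=
    Real.log_le_log (by positivity) (by gcongr; norm_num)
  have hD' : (1 : ℝ) ≤ D := by exact_mod_cast hD
  have hlogpos : 0 ≤ Real.log (16 / δ) :=
    Real.log_nonneg (by rw [le_div_iff₀ hδ]; linarith)
  have hmain : Real.log (1 / Δ) + Real.log (2 / δ) + D * Real.log (16 / δ) ≤ δ * m / 8 := by
    have h1 : Real.log (1 / Δ) + Real.log (2 / δ) + D * Real.log (16 / δ)
        ≤ 2 * c * (D * Real.log (1 / δ) + Real.log (1 / Δ)) := by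
      have h2 : Real.log (16 / δ) ≤ D * Real.log (16 / δ) := le_mul_of_one_le_left hlogpos hD'
      have h3 : D * Real.log (16 / δ) ≤ D * (c * Real.log (1 / δ)) := by gcongr
      have h4 : Real.log (1 / Δ) ≤ c * Real.log (1 / Δ) := le_mul_of_one_le_left hLΔ hc1
      nlinarith
    set Y := (D : ℝ) * Real.log (1 / δ) + Real.log (1 / Δ) with hY
    have hY0 : 0 ≤ Y := by
      have : 0 < Real.log (1 / δ) := hL₁.trans_le hL
      positivity
    have h5 : δ * (16 * c * (Y / δ ^ 2)) ≤ δ * m := by gcongr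
    -- A factor `1 / δ` is given away here.
    have h6 : 16 * c * Y ≤ δ * (16 * c * (Y / δ ^ 2)) := by
      have : δ * (16 * c * (Y / δ ^ 2)) = 16 * c * Y / δ := by field_simp
      rw [this, le_div_iff₀ hδ]
      exact mul_le_of_le_one_right (by positivity) (by linarith)
    linarith
  have hlhs : (1 + δ / 16) ^ (2 * m) ≤ Real.exp (δ * m / 8) := by
    calc (1 + δ / 16) ^ (2 * m) ≤ Real.exp (δ / 16) ^ (2 * m) := by
          gcongr
          rw [add_comm]
          exact Real.add_one_le_exp _
      _ = Real.exp (δ * m / 8) := by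
          rw [← Real.exp_nat_mul]
          congr 1
          push_cast
          ring
  have hpow : Real.exp (δ * m / 4) ≤ 2 ^ ⌈δ / 2 * m⌉₊ := by
    have h1 : (2 : ℝ) = Real.exp (Real.log 2) := (Real.exp_log (by norm_num)).symm
    rw [show (2 : ℝ) ^ ⌈δ / 2 * m⌉₊ = Real.exp (Real.log 2) ^ ⌈δ / 2 * m⌉₊ by rw [← h1],
      ← Real.exp_nat_mul, Real.exp_le_exp]
    have h2 := Nat.le_ceil (δ / 2 * m)
    have h3 := Real.log_two_gt_d9
    have h4 : 0 ≤ δ / 2 * m := by positivity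
    nlinarith
  have hcoef : Real.exp (-(δ * m / 8)) ≤ Δ * (δ / 2) * (δ / 16) ^ D := by
    have h1 : Δ * (δ / 2) * (δ / 16) ^ D
        = Real.exp (-(Real.log (1 / Δ) + Real.log (2 / δ) + D * Real.log (16 / δ))) := by
      rw [neg_add, neg_add, Real.exp_add, Real.exp_add, ← Real.log_inv, ← Real.log_inv,
        ← mul_neg, ← Real.log_inv, Real.exp_nat_mul, Real.exp_log (by positivity),
        Real.exp_log (by positivity), Real.exp_log (by positivity)]
      simp
    rw [h1, Real.exp_le_exp]
    linarith
  have hfin : (1 + δ / 16) ^ (2 * m) ≤ Δ * ((δ / 2) * ((δ / 16) ^ D * 2 ^ ⌈δ / 2 * m⌉₊)) := by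
    calc (1 + δ / 16) ^ (2 * m) ≤ Real.exp (δ * m / 8) := hlhs
      _ = Real.exp (-(δ * m / 8)) * Real.exp (δ * m / 4) := by
          rw [← Real.exp_add]
          congr 1
          ring
      _ ≤ (Δ * (δ / 2) * (δ / 16) ^ D) * 2 ^ ⌈δ / 2 * m⌉₊ := by gcongr
      _ = _ := by ring
  rw [mul_assoc] at hX
  exact le_of_mul_le_mul_right (hX.trans hfin) (by positivity)

/-! ### Existence of optimal solutions -/

/-- The equal split has no penalty and is feasible with some slack `ε₀`. Any pair doing as well has
slack at most `ε₀` and squared deviation at most `ε₀ / lam`, so it lies in a compact box. -/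
theorem exists_isSampledSolution {n m : ℕ} (hn : 1 ≤ n) (v : Coalition n → ℝ) {lam : ℝ}
    (hlam : 0 < lam) (C : Fin m → Coalition n) :
    ∃ (A : Fin n → ℝ) (ε : ℝ), IsSampledSolution v lam C A ε := by
  set c : ℝ := 1 / (n : ℝ) * v Finset.univ with hc
  have hn0 : (n : ℝ) ≠ 0 := by positivity
  obtain ⟨ε₀, hε₀⟩ : ∃ ε₀ : ℝ, IsSampledFeasible v C (fun _ => c) ε₀ := by
    refine ⟨∑ k, |v (C k) - ∑ i ∈ C k, c|, ⟨Finset.sum_nonneg fun _ _ => abs_nonneg _, ?_, ?_⟩⟩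
    · simp [hc, hn0]
    · intro k
      have h1 := Finset.single_le_sum (f := fun k => |v (C k) - ∑ i ∈ C k, c|)
        (fun _ _ => abs_nonneg _) (Finset.mem_univ k)
      have h2 := le_abs_self (v (C k) - ∑ i ∈ C k, c)
      linarith
  have hobj₀ : regularizedObjective v lam (fun _ => c) ε₀ = ε₀ := by
    simp [regularizedObjective, hc]
  -- The `+ 1` gives `ε₀ / lam ≤ R ^ 2` without a square root.
  set R : ℝ := ε₀ / lam + 1 with hR
  have hR1 : 1 ≤ R := by
    have := div_nonneg hε₀.slack_nonneg hlam.le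
    linarith
  let F : Set ((Fin n → ℝ) × ℝ) := {x | IsSampledFeasible v C x.1 x.2}
  let B : Set ((Fin n → ℝ) × ℝ) := Set.Icc (fun _ => c - R, 0) (fun _ => c + R, ε₀)
  have hF : IsClosed F := by
    have : F = {x | 0 ≤ x.2} ∩ ({x | ∑ i, x.1 i = v Finset.univ} ∩
        ⋂ k, {x | v (C k) - x.2 ≤ ∑ i ∈ C k, x.1 i}) := by
      ext x
      simp only [F, Set.mem_ofPred_eq, Set.mem_inter_iff, Set.mem_iInter]
      exact ⟨fun h => ⟨h.1, h.2, h.3⟩, fun h => ⟨h.1, h.2.1, h.2.2⟩⟩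
    rw [this]
    refine (isClosed_le (by fun_prop) (by fun_prop)).inter
      ((isClosed_eq (by fun_prop) (by fun_prop)).inter
        (isClosed_iInter fun k => isClosed_le (by fun_prop) (by fun_prop)))
  have hK : IsCompact (F ∩ B) := isCompact_Icc.inter_left hF
  have hne : (F ∩ B).Nonempty := by
    refine ⟨(fun _ => c, ε₀), hε₀, ⟨fun _ => ?_, hε₀.slack_nonneg⟩, ⟨fun _ => ?_, le_rfl⟩⟩ <;>
      simp <;> linarith
  have hcont : Continuous fun x : (Fin n → ℝ) × ℝ => regularizedObjective v lam x.1 x.2 := by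
    unfold regularizedObjective
    fun_prop
  obtain ⟨x, hx, hmin⟩ := hK.exists_isMinOn hne hcont.continuousOn
  have hx₀ : regularizedObjective v lam x.1 x.2 ≤ ε₀ := by
    rw [← hobj₀]
    refine hmin (a := (fun _ => c, ε₀)) ⟨hε₀, ⟨fun _ => ?_, hε₀.slack_nonneg⟩,
      ⟨fun _ => ?_, le_rfl⟩⟩ <;>
      simp <;> linarith
  refine ⟨x.1, x.2, hx.1, fun A ε hA => ?_⟩
  by_cases hle : regularizedObjective v lam A ε ≤ ε₀
  · have hsq : 0 ≤ ∑ i, (A i - c) ^ 2 := Finset.sum_nonneg fun _ _ => sq_nonneg _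
    have hle' : ε + lam * ∑ i, (A i - c) ^ 2 ≤ ε₀ := hle
    have hdev : ∀ i, |A i - c| ≤ R := by
      intro i
      have h1 := Finset.single_le_sum (f := fun i => (A i - c) ^ 2) (fun _ _ => sq_nonneg _)
        (Finset.mem_univ i)
      have h2 : ∑ i, (A i - c) ^ 2 ≤ ε₀ / lam := by
        rw [le_div_iff₀ hlam]
        linarith [hA.slack_nonneg]
      refine abs_le_of_sq_le_sq ?_ (by linarith)
      nlinarith
    refine hmin (a := (A, ε)) ⟨hA, ⟨fun i => ?_, hA.slack_nonneg⟩, ⟨fun i => ?_, ?_⟩⟩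
    · have := (abs_le.1 (hdev i)).1
      simp only
      linarith
    · have := (abs_le.1 (hdev i)).2
      simp only
      linarith
    · have := mul_nonneg hlam.le hsq
      simp only
      linarith
  · exact hx₀.trans (not_le.1 hle).le

/-! ### From nets to the probable core -/

open Classical in
theorem measureReal_pi_eq_sum {α : Type*} [Fintype α] [MeasurableSpace α]
    [MeasurableSingletonClass α] (P : Measure α) [IsProbabilityMeasure P] {m : ℕ}
    (E : Set (Fin m → α)) :
    (Measure.pi fun _ : Fin m => P).real E
      = ∑ x : Fin m → α, (∏ i, P.real {x i}) * (if x ∈ E then 1 else 0) := by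
  have h := sum_measureReal_singleton (μ := Measure.pi fun _ : Fin m => P)
    (Finset.univ.filter fun x => x ∈ E)
  rw [Finset.coe_filter] at h
  simp only [Finset.mem_univ, true_and, Set.ofPred_mem_eq] at h
  rw [← h, Finset.sum_filter]
  refine Finset.sum_congr rfl fun x _ => ?_
  split_ifs <;> simp [Measure.real, ENNReal.toReal_prod]

theorem mainTheorem3 (δ₀ : ℝ) (hδ₀ : δ₀ < 1) :
    ∃ K : ℝ, 0 < K ∧
      ∀ (n : ℕ), 1 ≤ n →
      ∀ (v : Coalition n → ℝ) (lam : ℝ) (P : Measure (Coalition n)) [IsProbabilityMeasure P]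
        (δ Δ : ℝ), 0 < δ → δ ≤ δ₀ → 0 < Δ →
      ∀ m : ℕ,
        K * ((((n : ℝ) + 2) * Real.log (1 / δ) + Real.log (1 / Δ)) / δ ^ 2) ≤ (m : ℝ) →
        (0 < lam → ∀ C : Fin m → Coalition n, ∃ (A : Fin n → ℝ) (ε : ℝ),
          IsSampledSolution v lam C A ε) ∧
        1 - Δ ≤ (Measure.pi fun _ : Fin m => P).real
          {C | ∀ (A : Fin n → ℝ) (ε : ℝ), IsSampledSolution v lam C A ε →
            A ∈ probableCore v P ε δ} := by
  classical
  -- `δ₀` may be nonpositive; the maximum makes `log (1 / δ₁)` positive.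
  set δ₁ := max δ₀ (1 / 2) with hδ₁
  have hδ₁1 : δ₁ < 1 := max_lt hδ₀ (by norm_num)
  have hδ₁0 : 0 < δ₁ := lt_max_of_lt_right (by norm_num)
  have hL₁ : 0 < Real.log (1 / δ₁) := Real.log_pos (by rw [lt_div_iff₀ hδ₁0]; linarith)
  have h16 : 0 < Real.log 16 := Real.log_pos (by norm_num)
  refine ⟨16 * (Real.log 16 / Real.log (1 / δ₁) + 1), by positivity, ?_⟩
  intro n hn v lam P _ δ Δ hδ hδδ₀ hΔ m hm
  refine ⟨fun hlam C => exists_isSampledSolution hn v hlam C, ?_⟩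
  rcases le_or_gt 1 Δ with hΔ1 | hΔ1
  · exact le_trans (by linarith) measureReal_nonneg
  have hm0 : 0 < m := by
    have h1 : 0 < Real.log (1 / δ) := Real.log_pos (by rw [lt_div_iff₀ hδ]; linarith)
    have h2 : 0 < Real.log (1 / Δ) := Real.log_pos (by rw [lt_div_iff₀ hΔ]; linarith)
    have h3 : (0 : ℝ) < m := lt_of_lt_of_le (by positivity) hm
    exact_mod_cast h3
  have : Nonempty (Fin m) := ⟨⟨0, hm0⟩⟩
  set p : Coalition n → ℝ := fun C => P.real {C} with hp
  have hp1 : ∑ C, p C = 1 := by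
    have := sum_measureReal_singleton (μ := P) Finset.univ
    rw [hp, this]
    simp
  set G : Set (Fin m → Coalition n) := {C | ∀ (A : Fin n → ℝ) (ε : ℝ),
    IsSampledSolution v lam C A ε → A ∈ probableCore v P ε δ} with hG
  have hnet := prob_not_net_mul_le (ι := Fin m) (p := p) (fun _ => measureReal_nonneg) hp1
    (violationSets v) (vcDim_violationSets_le v) hδ (t := δ / 16) (by positivity) (by linarith)
  rw [Fintype.card_fin] at hnet
  have hX := le_of_net_bound hδ₁1 hδ (hδδ₀.trans (le_max_left _ _)) hΔ hΔ1.le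
    (by omega : 1 ≤ n + 2) (by push_cast; exact hm) hnet
  have hbad : (Measure.pi fun _ : Fin m => P).real Gᶜ ≤ Δ := by
    refine le_trans ?_ hX
    rw [measureReal_pi_eq_sum]
    refine Finset.sum_le_sum fun x _ => mul_le_mul_of_nonneg_left ?_
      (Finset.prod_nonneg fun _ _ => measureReal_nonneg)
    split_ifs with h1 h2
    · exact le_rfl
    · refine absurd ?_ h2
      simp only [hG, Set.mem_compl_iff, Set.mem_ofPred_eq, not_forall] at h1
      obtain ⟨A, ε, hsol, hA⟩ := h1
      -- The violation set of the bad solution is heavy yet missed by the sample.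
      refine ⟨Finset.univ.filter fun C => ∑ i ∈ C, A i < v C - ε,
        (mem_violationSets v).2 ⟨A, ε, by simp⟩, ?_, fun i => ?_⟩
      · have hcore : P.real {C | v C - ε ≤ ∑ i ∈ C, A i} < 1 - δ := by
          by_contra! h
          exact hA ⟨hsol.feasible.efficient, h⟩
        have hcompl : P.real {C | v C - ε ≤ ∑ i ∈ C, A i}ᶜ
            = 1 - P.real {C | v C - ε ≤ ∑ i ∈ C, A i} := probReal_compl_eq_one_sub trivial
        have hset : ((Finset.univ.filter fun C => ∑ i ∈ C, A i < v C - ε : Finset (Coalition n)) :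
            Set (Coalition n)) = {C | v C - ε ≤ ∑ i ∈ C, A i}ᶜ := by
          ext C
          simp [lt_sub_iff_add_lt]
        rw [hp, sum_measureReal_singleton, hset, hcompl]
        linarith
      · simpa using hsol.feasible.rational i
    · exact zero_le_one
    · exact le_rfl
  have hcompl := probReal_compl_eq_one_sub (μ := Measure.pi fun _ : Fin m => P) (s := G)
    G.toFinite.measurableSet
  linarith
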